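/- For a Young diagram $\kappa$, let $s_\kappa=\sum_T x^T$ be the Schur function in the countably many variables $x_1,x_2,\ldots$ (a formal power series with integer coefficients), where $T$ runs over the semistandard Young tableaux of shape $\kappa$ and $x^T$ is the product of the variables $x_i$ over the entries $i$ of $T$. If $\kappa$ is nonempty, let $s_{\kappa/1}$ be the skew Schur function, defined in the same way, of the skew shape obtained from $\kappa$ by removing its top-left box; if $\kappa=\varnothing$, put $s_{\kappa/1}=0$. A partition is a finite weakly decreasing sequence of nonnegative integers (trailing zeros allowed), identified with its Young diagram; the empty sequence is the empty partition. For a finite integer sequence $\kappa$ that is not a partition, put $s_\kappa=s_{\kappa/1}=0$. Let $k\ge 1$, let $\lambda=(\lambda_1,\ldots,\lambda_k)$ be a partition and let $0\le t\le k-1$. Then $$s_{\lambda/1}\,s_{(\lambda_1,\ldots,\lambda_t,\lambda_{t+2}-1,\ldots,\lambda_k-1)} = s_{(\lambda_1,\ldots,\lambda_t,\lambda_{t+2}-1,\ldots,\lambda_k-1)/1}\,s_\lambda + s_{(\lambda_1-1,\ldots,\lambda_k-1)}\,s_{(\lambda_1+1,\ldots,\lambda_t+1,\lambda_{t+2},\ldots,\lambda_k)}.$$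 -/

import Mathlib

/-- A semistandard filling of the skew diagram `μ / ν`, i.e. of the cells of `μ` that are not in
`ν`: rows weakly increase, columns strictly increase. As in Mathlib's
`SemistandardYoungTableau`, the entries are natural numbers and, for extensionality, the filling
is `0` outside the skew diagram. -/
@[ext]
structure SkewTableau (μ ν : YoungDiagram) where
  entry : ℕ → ℕ → ℕ
  row_weak : ∀ {i j1 j2 : ℕ}, j1 < j2 → (i, j1) ∉ ν → (i, j2) ∈ μ → entry i j1 ≤ entry i j2
  col_strict : ∀ {i1 i2 j : ℕ}, i1 < i2 → (i1, j) ∉ ν → (i2, j) ∈ μ → entry i1 j < entry i2 j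
  zeros : ∀ {i j : ℕ}, ¬ ((i, j) ∈ μ ∧ (i, j) ∉ ν) → entry i j = 0

/-- The exponent vector of the monomial `x^T`: the `n`-th component is the number of entries of
`T` equal to `n`. -/
noncomputable def tableauContent {μ : YoungDiagram} (T : SemistandardYoungTableau μ) : ℕ →₀ ℕ :=
  ∑ c ∈ μ.cells, Finsupp.single (T c.1 c.2) 1

/-- The exponent vector of the monomial `x^T` of a skew tableau. -/
noncomputable def skewContent {μ ν : YoungDiagram} (T : SkewTableau μ ν) : ℕ →₀ ℕ :=
  ∑ c ∈ μ.cells \ ν.cells, Finsupp.single (T.entry c.1 c.2) 1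

/-- Only finitely many tableaux of a given shape have a given content. -/
theorem finite_tableauContent (μ : YoungDiagram) (d : ℕ →₀ ℕ) :
    Finite {T : SemistandardYoungTableau μ // tableauContent T = d} := by
  classical
  have key : ∀ T : {T : SemistandardYoungTableau μ // tableauContent T = d},
      ∀ c : μ.cells, T.1 c.1.1 c.1.2 ∈ d.support := by
    rintro ⟨T, hT⟩ c
    subst hT
    rw [Finsupp.mem_support_iff]
    dsimp only
    unfold tableauContent
    rw [Finsupp.finsetSum_apply]
    exact (Finset.sum_pos' (fun _ _ => Nat.zero_le _) ⟨c.1, c.2, by simp⟩).ne'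
  refine Finite.of_injective
    (fun T (c : μ.cells) => (⟨T.1 c.1.1 c.1.2, key T c⟩ : d.support)) ?_
  intro T T' h
  apply Subtype.ext
  ext i j
  by_cases hc : (i, j) ∈ μ
  · have := congrFun h ⟨(i, j), hc⟩
    simpa using this
  · rw [T.1.zeros hc, T'.1.zeros hc]

/-- Only finitely many skew tableaux of a given shape have a given content. -/
theorem finite_skewContent (μ ν : YoungDiagram) (d : ℕ →₀ ℕ) :
    Finite {T : SkewTableau μ ν // skewContent T = d} := by
  classical
  have key : ∀ T : {T : SkewTableau μ ν // skewContent T = d},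
      ∀ c : (μ.cells \ ν.cells : Finset (ℕ × ℕ)), T.1.entry c.1.1 c.1.2 ∈ d.support := by
    rintro ⟨T, hT⟩ c
    subst hT
    rw [Finsupp.mem_support_iff]
    dsimp only
    unfold skewContent
    rw [Finsupp.finsetSum_apply]
    exact (Finset.sum_pos' (fun _ _ => Nat.zero_le _) ⟨c.1, c.2, by simp⟩).ne'
  refine Finite.of_injective
    (fun T (c : (μ.cells \ ν.cells : Finset (ℕ × ℕ))) =>
      (⟨T.1.entry c.1.1 c.1.2, key T c⟩ : d.support)) ?_
  intro T T' h
  apply Subtype.ext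
  ext i j
  by_cases hc : (i, j) ∈ μ ∧ (i, j) ∉ ν
  · have := congrFun h ⟨(i, j), by simpa using hc⟩
    simpa using this
  · rw [T.1.zeros hc, T'.1.zeros hc]

/-- The Schur function `s_μ = ∑_T x^T` in countably many variables, as a formal power series:
the coefficient of `x^d` is the number of semistandard tableaux of shape `μ` and content `d`. -/
noncomputable def diagramSchur (μ : YoungDiagram) : MvPowerSeries ℕ ℤ :=
  fun d => (Nat.card {T : SemistandardYoungTableau μ // tableauContent T = d} : ℤ)

open Classical in
/-- The skew Schur function `s_{μ/ν} = ∑_T x^T`, which is `0` by the standard convention unless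
`ν ⊆ μ`. -/
noncomputable def diagramSkewSchur (μ ν : YoungDiagram) : MvPowerSeries ℕ ℤ :=
  if ν ≤ μ then fun d => (Nat.card {T : SkewTableau μ ν // skewContent T = d} : ℤ) else 0

/-- A finite integer sequence is a partition if it is weakly decreasing with nonnegative terms;
trailing zeros are allowed. -/
def IsPartitionSeq {k : ℕ} (α : Fin k → ℤ) : Prop :=
  Antitone α ∧ ∀ i, 0 ≤ α i

theorem IsPartitionSeq.sortedGE {k : ℕ} {α : Fin k → ℤ} (h : IsPartitionSeq α) :
    (List.ofFn fun i => (α i).toNat).SortedGE :=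
  List.sortedGE_ofFn_iff.mpr fun _ _ hij => Int.toNat_le_toNat (h.1 hij)

/-- The Young diagram of a partition, with `α i` cells in row `i`. -/
def IsPartitionSeq.diagram {k : ℕ} {α : Fin k → ℤ} (h : IsPartitionSeq α) : YoungDiagram :=
  YoungDiagram.ofRowLens (List.ofFn fun i => (α i).toNat) h.sortedGE

/-- The Young diagram consisting of one cell. -/
def oneCell : YoungDiagram :=
  YoungDiagram.ofRowLens [1] (List.sortedGE_iff_pairwise.mpr (by simp))

open Classical in
/-- `s_α` for an integer sequence `α`, taken to be `0` if `α` is not a partition. -/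
noncomputable def schurS {k : ℕ} (α : Fin k → ℤ) : MvPowerSeries ℕ ℤ :=
  if h : IsPartitionSeq α then diagramSchur h.diagram else 0

open Classical in
/-- `s_{α/1}`, the skew Schur function of `α` with its top-left cell removed, taken to be `0` if
`α` is not a partition (and also if `α` is empty, see `diagramSkewSchur`). -/
noncomputable def schurSkewOne {k : ℕ} (α : Fin k → ℤ) : MvPowerSeries ℕ ℤ :=
  if h : IsPartitionSeq α then diagramSkewSchur h.diagram oneCell else 0

/-- For `α = (α_1, …, α_{k+1})`, the sequence `(α_1, …, α_t, α_{t+2} - 1, …, α_{k+1} - 1)`. Indices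
in Lean start at `0`. -/
def omitLower {k : ℕ} (α : Fin (k + 1) → ℤ) (t : ℕ) : Fin k → ℤ :=
  fun i => if (i : ℕ) < t then α i.castSucc else α i.succ - 1

/-- For `α = (α_1, …, α_{k+1})`, the sequence `(α_1 + 1, …, α_t + 1, α_{t+2}, …, α_{k+1})`. -/
def omitRaise {k : ℕ} (α : Fin (k + 1) → ℤ) (t : ℕ) : Fin k → ℤ :=
  fun i => if (i : ℕ) < t then α i.castSucc + 1 else α i.succ

/-! The identity is a three-term Plücker relation between Jacobi–Trudi determinants. Let `m + 2` be
the number of parts of `α`, and let `w b` be the vector with coordinates $h_{\alpha_i-i-1+b}$ for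
$0\le b\le m+2$ (rows numbered from 0). The determinants of $w_1,\dots,w_{m+2}$, of
$w_0,w_2,\dots,w_{m+2}$ and of $w_0,\dots,w_{m+1}$ are $s_\alpha$, $s_{\alpha/1}$ and
$s_{\alpha-1}$. Deleting the part of index `t` and lowering the later ones by 1 only deletes the
coordinate `t` from these vectors (`omitLower_sub`), so the other three factors are minors of the
same vectors without that coordinate, i.e. determinants bordered by a unit vector. The relation
`det_mul_det_succAbove` follows from Cramer's rule.

The Jacobi–Trudi formula `boundedSkewSchur_eq_det` is proved in finitely many variables by induction
on their number. Removing the cells with the largest entry strips a horizontal strip off the outer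
shape (`boundedSkewSchur_succ`); row operations and multilinearity give the determinant the same
recursion (`det_completeHom_succ`). A coefficient of a power series involves only finitely many
variables, so the polynomial identities suffice (`AgreeBelow`). -/

/-! ### Bounded skew tableaux and horizontal strips -/

namespace SkewTableau

variable {μ ν : YoungDiagram}

theorem entry_mono (T : SkewTableau μ ν) {i₁ i₂ j₁ j₂ : ℕ} (hi : i₁ ≤ i₂) (hj : j₁ ≤ j₂)
    (h₁ : (i₁, j₁) ∉ ν) (h₂ : (i₂, j₂) ∈ μ) : T.entry i₁ j₁ ≤ T.entry i₂ j₂ := by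
  have h₃ : (i₂, j₁) ∉ ν := fun h => h₁ (ν.up_left_mem hi le_rfl h)
  have h₄ : (i₂, j₁) ∈ μ := μ.up_left_mem le_rfl hj h₂
  refine le_trans (b := T.entry i₂ j₁) ?_ ?_
  · rcases hi.eq_or_lt with rfl | hi
    · exact le_rfl
    · exact (T.col_strict hi h₁ h₄).le
  · rcases hj.eq_or_lt with rfl | hj
    · exact le_rfl
    · exact T.row_weak hj h₃ h₂

/-- All entries of the tableau are smaller than `n`. -/
def Bounded (n : ℕ) (T : SkewTableau μ ν) : Prop :=
  ∀ ⦃i j : ℕ⦄, (i, j) ∈ μ → (i, j) ∉ ν → T.entry i j < n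

instance (n : ℕ) : Finite {T : SkewTableau μ ν // T.Bounded n} := by
  refine Finite.of_injective
    (fun T (c : (μ.cells \ ν.cells : Finset (ℕ × ℕ))) =>
      (⟨T.1.entry c.1.1 c.1.2, T.2 ((YoungDiagram.mem_cells _).1 (Finset.mem_sdiff.1 c.2).1)
        fun h => (Finset.mem_sdiff.1 c.2).2 ((YoungDiagram.mem_cells _).2 h)⟩ : Fin n)) ?_
  intro T T' h
  apply Subtype.ext
  ext i j
  by_cases hc : (i, j) ∈ μ ∧ (i, j) ∉ ν
  · have := congrFun h ⟨(i, j), by simpa using hc⟩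
    simpa using this
  · rw [T.1.zeros hc, T'.1.zeros hc]

noncomputable instance (n : ℕ) : Fintype {T : SkewTableau μ ν // T.Bounded n} :=
  Fintype.ofFinite _

theorem bounded_of_support_subset {n : ℕ} (T : SkewTableau μ ν)
    (h : (skewContent T).support ⊆ Finset.range n) : T.Bounded n := by
  intro i j h₁ h₂
  rw [← Finset.mem_range]
  apply h
  rw [Finsupp.mem_support_iff]
  unfold skewContent
  rw [Finsupp.finsetSum_apply]
  exact (Finset.sum_pos' (fun _ _ => Nat.zero_le _) ⟨(i, j), by simp [h₁, h₂], by simp⟩).ne'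

/-- The diagram formed by the inner shape and the cells with entry smaller than `n`. -/
def lowerPart (T : SkewTableau μ ν) (n : ℕ) : YoungDiagram where
  cells := μ.cells.filter fun c => c ∈ ν ∨ T.entry c.1 c.2 < n
  isLowerSet := by
    rintro ⟨i₂, j₂⟩ ⟨i₁, j₁⟩ ⟨hi, hj⟩ h
    simp only [Finset.coe_filter, YoungDiagram.mem_cells, Set.mem_ofPred_eq] at h ⊢
    refine ⟨μ.up_left_mem hi hj h.1, ?_⟩
    by_cases h₁ : (i₁, j₁) ∈ ν
    · exact Or.inl h₁
    · refine Or.inr (lt_of_le_of_lt (T.entry_mono hi hj h₁ h.1) (h.2.resolve_left ?_))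
      exact fun h₂ => h₁ (ν.up_left_mem hi hj h₂)

theorem mem_lowerPart {T : SkewTableau μ ν} {n i j : ℕ} :
    (i, j) ∈ T.lowerPart n ↔ (i, j) ∈ μ ∧ ((i, j) ∈ ν ∨ T.entry i j < n) := by
  rw [← YoungDiagram.mem_cells]
  simp [lowerPart]

open Classical in
/-- The restriction of a tableau to a smaller outer shape. -/
noncomputable def restrict (T : SkewTableau μ ν) {κ : YoungDiagram} (h : κ ≤ μ) :
    SkewTableau κ ν where
  entry i j := if (i, j) ∈ κ then T.entry i j else 0
  row_weak {i j₁ j₂} hj h₁ h₂ := by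
    rw [if_pos h₂, if_pos (κ.up_left_mem le_rfl hj.le h₂)]
    exact T.row_weak hj h₁ (h h₂)
  col_strict {i₁ i₂ j} hi h₁ h₂ := by
    rw [if_pos h₂, if_pos (κ.up_left_mem hi.le le_rfl h₂)]
    exact T.col_strict hi h₁ (h h₂)
  zeros {i j} hc := by
    split_ifs with h₁
    · exact T.zeros fun h₂ => hc ⟨h₁, h₂.2⟩
    · rfl

open Classical in
/-- The extension of a tableau with entries smaller than `n` by entries `n` along a horizontal
strip. -/
noncomputable def extend {κ : YoungDiagram} {n : ℕ} (T : SkewTableau κ ν) (hT : T.Bounded n)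
    (hν : ν ≤ κ) (hκ : κ ≤ μ) (hs : ∀ i j, (i + 1, j) ∈ μ → (i, j) ∈ κ) : SkewTableau μ ν where
  entry i j := if (i, j) ∈ κ then T.entry i j else if (i, j) ∈ μ then n else 0
  row_weak {i j₁ j₂} hj h₁ h₂ := by
    by_cases h₃ : (i, j₂) ∈ κ
    · rw [if_pos h₃, if_pos (κ.up_left_mem le_rfl hj.le h₃)]
      exact T.row_weak hj h₁ h₃
    · rw [if_neg h₃, if_pos h₂]
      by_cases h₄ : (i, j₁) ∈ κ
      · rw [if_pos h₄]
        exact (hT h₄ h₁).le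
      · rw [if_neg h₄]
        split_ifs <;> simp
  col_strict {i₁ i₂ j} hi h₁ h₂ := by
    have h₄ : (i₁, j) ∈ κ := hs _ _ (μ.up_left_mem hi le_rfl h₂)
    rw [if_pos h₄]
    by_cases h₃ : (i₂, j) ∈ κ
    · rw [if_pos h₃]
      exact T.col_strict hi h₁ h₃
    · rw [if_neg h₃, if_pos h₂]
      exact hT h₄ h₁
  zeros {i j} hc := by
    by_cases h₁ : (i, j) ∈ κ
    · rw [if_pos h₁]
      exact T.zeros fun h₂ => hc ⟨hκ h₁, h₂.2⟩
    · rw [if_neg h₁, if_neg]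
      exact fun h₂ => hc ⟨h₂, fun h₃ => h₁ (hν h₃)⟩

end SkewTableau

/-- The outer shapes that remain when a horizontal strip is removed from `μ`. -/
def horizontalStrips (μ : YoungDiagram) : Set YoungDiagram :=
  {κ | κ ≤ μ ∧ ∀ i j, (i + 1, j) ∈ μ → (i, j) ∈ κ}

theorem finite_horizontalStrips (μ : YoungDiagram) : (horizontalStrips μ).Finite := by
  refine Set.Finite.of_finite_image
    (f := YoungDiagram.cells) ((μ.cells.powerset.finite_toSet).subset ?_) ?_
  · rintro _ ⟨κ, hκ, rfl⟩
    simpa using hκ.1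
  · intro a _ b _ h
    exact YoungDiagram.ext h

namespace SkewTableau

variable {μ ν : YoungDiagram}

/-- A cell with a cell below it has an entry smaller than that one, hence smaller than `n`, so each
column has at most one `n`. -/
theorem lowerPart_mem_horizontalStrips {n : ℕ} {T : SkewTableau μ ν} (hT : T.Bounded (n + 1)) :
    T.lowerPart n ∈ horizontalStrips μ := by
  constructor
  · rintro ⟨i, j⟩ h
    exact (mem_lowerPart.1 h).1
  · intro i j h
    refine mem_lowerPart.2 ⟨μ.up_left_mem (Nat.le_succ i) le_rfl h, ?_⟩
    by_cases h₁ : (i, j) ∈ ν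
    · exact Or.inl h₁
    · right
      have h₂ : (i + 1, j) ∉ ν := fun h₃ => h₁ (ν.up_left_mem (Nat.le_succ i) le_rfl h₃)
      have := T.col_strict (Nat.lt_add_one i) h₁ h
      have := hT h h₂
      omega

theorem skewContent_eq_restrict_add {n : ℕ} {T : SkewTableau μ ν} (hT : T.Bounded (n + 1))
    {κ : YoungDiagram} (hκ : T.lowerPart n = κ) (hμ : κ ≤ μ) (hν : ν ≤ κ) :
    skewContent T = skewContent (T.restrict hμ) + Finsupp.single n (μ.card - κ.card) := by
  classical
  have hsub : κ.cells \ ν.cells ⊆ μ.cells \ ν.cells :=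
    Finset.sdiff_subset_sdiff hμ subset_rfl
  have hdiff : (μ.cells \ ν.cells) \ (κ.cells \ ν.cells) = μ.cells \ κ.cells := by
    ext c
    have h₁ : c ∈ ν → c ∈ κ := fun h => hν h
    simp only [Finset.mem_sdiff, YoungDiagram.mem_cells]
    tauto
  unfold skewContent
  rw [← Finset.sum_sdiff hsub, hdiff, add_comm]
  congr 1
  · refine Finset.sum_congr rfl fun c hc => ?_
    have : c ∈ κ := by simpa using (Finset.mem_sdiff.1 hc).1
    simp [restrict, this]
  · rw [Finset.sum_congr rfl (g := fun _ => Finsupp.single n 1)]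
    · rw [Finset.sum_const, Finset.card_sdiff_of_subset hμ]
      simp
    · rintro ⟨i, j⟩ hc
      rw [Finset.mem_sdiff, YoungDiagram.mem_cells, YoungDiagram.mem_cells, ← hκ,
        mem_lowerPart] at hc
      have h₂ : (i, j) ∉ ν := fun h => hc.2 ⟨hc.1, Or.inl h⟩
      have h₃ : ¬ T.entry i j < n := fun h => hc.2 ⟨hc.1, Or.inr h⟩
      have := hT hc.1 h₂
      rw [show T.entry i j = n by omega]

end SkewTableau

/-! ### Schur polynomials in finitely many variables and their branching rule -/

open Classical in
/-- The skew Schur polynomial in the variables `x_0, …, x_{n-1}`. -/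
noncomputable def boundedSkewSchur (n : ℕ) (μ ν : YoungDiagram) : MvPolynomial ℕ ℤ :=
  if ν ≤ μ then ∑ T : {T : SkewTableau μ ν // T.Bounded n},
    MvPolynomial.monomial (skewContent T.1) 1 else 0

theorem coeff_diagramSkewSchur_of_le {μ ν : YoungDiagram} (h : ν ≤ μ) (d : ℕ →₀ ℕ) :
    MvPowerSeries.coeff d (diagramSkewSchur μ ν) =
      (Nat.card {T : SkewTableau μ ν // skewContent T = d} : ℤ) := by
  have : diagramSkewSchur μ ν =
      fun d => (Nat.card {T : SkewTableau μ ν // skewContent T = d} : ℤ) := if_pos h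
  rw [this]
  rfl

/-- A tableau whose content is supported below `n` is automatically bounded by `n`, so both sides
count the same tableaux. -/
theorem coeff_diagramSkewSchur {n : ℕ} {d : ℕ →₀ ℕ} (h : d.support ⊆ Finset.range n)
    (μ ν : YoungDiagram) :
    MvPowerSeries.coeff d (diagramSkewSchur μ ν) = (boundedSkewSchur n μ ν).coeff d := by
  classical
  by_cases hνμ : ν ≤ μ
  · rw [coeff_diagramSkewSchur_of_le hνμ, boundedSkewSchur, if_pos hνμ, MvPolynomial.coeff_sum]
    simp only [MvPolynomial.coeff_monomial, Finset.sum_boole]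
    rw [← Fintype.card_subtype, ← Nat.card_eq_fintype_card]
    congr 1
    refine Nat.card_congr
      ⟨fun T => ⟨⟨T.1, T.1.bounded_of_support_subset (by rw [T.2]; exact h)⟩, T.2⟩,
        fun T => ⟨T.1.1, T.2⟩, fun _ => rfl, fun _ => rfl⟩
  · have h₀ : diagramSkewSchur μ ν = 0 := if_neg hνμ
    rw [h₀, boundedSkewSchur, if_neg hνμ]
    simp

theorem boundedSkewSchur_zero (μ ν : YoungDiagram) [Decidable (μ = ν)] :
    boundedSkewSchur 0 μ ν = if μ = ν then 1 else 0 := by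
  classical
  unfold boundedSkewSchur
  split_ifs with h₁ h₂ h₂
  · subst h₂
    have hc : ∀ i j, ¬ ((i, j) ∈ μ ∧ (i, j) ∉ μ) := fun i j h => h.2 h.1
    let T₀ : SkewTableau μ μ :=
      ⟨fun _ _ => 0, fun _ _ _ => le_rfl,
        fun h h₁ h₂ => (h₁ (μ.up_left_mem (le_of_lt h) le_rfl h₂)).elim, fun _ => rfl⟩
    rw [Fintype.sum_eq_single (⟨T₀, fun i j h h' => (h' h).elim⟩ : {T : SkewTableau μ μ // T.Bounded 0})]
    · simp [skewContent]
    · intro T hT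
      refine (hT (Subtype.ext ?_)).elim
      ext i j
      rw [T.1.zeros (hc i j), T₀.zeros (hc i j)]
  · refine Finset.sum_eq_zero fun T _ => (h₂ (le_antisymm ?_ h₁)).elim
    rintro ⟨i, j⟩ h
    by_contra h'
    exact Nat.not_lt_zero _ (T.2 h h')
  · exact (h₁ h₂.ge).elim
  · rfl

/-- Tableaux are sorted by the shape `κ` occupied by `ν` and the entries below `n`. All cells of `μ`
outside `κ` contain `n`, so restriction to `κ` and extension by `n` are mutually inverse. -/
theorem boundedSkewSchur_succ (n : ℕ) (μ ν : YoungDiagram) :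
    boundedSkewSchur (n + 1) μ ν = ∑ κ ∈ (finite_horizontalStrips μ).toFinset,
      MvPolynomial.X n ^ (μ.card - κ.card) * boundedSkewSchur n κ ν := by
  classical
  by_cases hνμ : ν ≤ μ
  swap
  · rw [boundedSkewSchur, if_neg hνμ, Finset.sum_eq_zero]
    intro κ hκ
    rw [Set.Finite.mem_toFinset] at hκ
    rw [boundedSkewSchur, if_neg fun h => hνμ (h.trans hκ.1), mul_zero]
  rw [boundedSkewSchur, if_pos hνμ, ← Finset.sum_fiberwise_of_maps_to
    (t := (finite_horizontalStrips μ).toFinset) (g := fun T => T.1.lowerPart n)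
    fun T _ => (Set.Finite.mem_toFinset _).2 (SkewTableau.lowerPart_mem_horizontalStrips T.2)]
  refine Finset.sum_congr rfl fun κ hκ => ?_
  rw [Set.Finite.mem_toFinset] at hκ
  rw [boundedSkewSchur]
  split_ifs with hνκ
  · rw [Finset.mul_sum]
    refine Finset.sum_bij' (fun T _ => ⟨T.1.restrict hκ.1, ?_⟩)
      (fun T _ => ⟨T.1.extend T.2 hνκ hκ.1 hκ.2, ?_⟩) ?_ ?_ ?_ ?_ ?_
    · rename_i hT
      intro i j h h'
      have h₁ := (Finset.mem_filter.1 hT).2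
      have h₂ := h
      rw [← h₁, SkewTableau.mem_lowerPart] at h₂
      simpa [SkewTableau.restrict, h] using h₂.2.resolve_left h'
    · intro i j h h'
      by_cases h₁ : (i, j) ∈ κ
      · simpa [SkewTableau.extend, h₁] using (T.2 h₁ h').trans (Nat.lt_succ_self n)
      · simp [SkewTableau.extend, h₁, h]
    · intro T _
      exact Finset.mem_univ _
    · intro T _
      rw [Finset.mem_filter]
      refine ⟨Finset.mem_univ _, ?_⟩
      apply YoungDiagram.ext
      ext ⟨i, j⟩
      rw [YoungDiagram.mem_cells, YoungDiagram.mem_cells, SkewTableau.mem_lowerPart]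
      have h₂ : (i, j) ∈ κ → (i, j) ∈ μ := fun h => hκ.1 h
      have h₃ : (i, j) ∈ ν → (i, j) ∈ κ := fun h => hνκ h
      by_cases h₁ : (i, j) ∈ κ
      · have h₄ : (i, j) ∉ ν → T.1.entry i j < n := T.2 h₁
        simp only [SkewTableau.extend, h₁, if_true]
        tauto
      · by_cases h₄ : (i, j) ∈ μ
        · simp only [SkewTableau.extend, h₁, h₄, if_true, if_false]
          simp only [lt_irrefl]
          tauto
        · tauto
    · intro T hT
      have h₁ := (Finset.mem_filter.1 hT).2
      apply Subtype.ext
      ext i j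
      by_cases h₂ : (i, j) ∈ κ
      · simp [SkewTableau.extend, SkewTableau.restrict, h₂]
      · by_cases h₃ : (i, j) ∈ μ
        · simp only [SkewTableau.extend, h₂, h₃, if_true, if_false]
          have h₄ : (i, j) ∉ ν := fun h => h₂ (hνκ h)
          rw [← h₁, SkewTableau.mem_lowerPart] at h₂
          have h₅ := T.2 h₃ h₄
          have h₆ : ¬ T.1.entry i j < n := fun h => h₂ ⟨h₃, Or.inr h⟩
          omega
        · simp only [SkewTableau.extend, h₂, h₃, if_false]
          exact (T.1.zeros fun h => h₃ h.1).symm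
    · intro T _
      apply Subtype.ext
      ext i j
      by_cases h₂ : (i, j) ∈ κ
      · simp [SkewTableau.extend, SkewTableau.restrict, h₂]
      · simp only [SkewTableau.restrict, h₂, if_false]
        exact (T.1.zeros fun h => h₂ h.1).symm
    · intro T hT
      rw [SkewTableau.skewContent_eq_restrict_add T.2 (Finset.mem_filter.1 hT).2 hκ.1 hνκ,
        MvPolynomial.X_pow_eq_monomial, MvPolynomial.monomial_mul, add_comm, mul_one]
  · rw [mul_zero, Finset.sum_eq_zero]
    intro T hT
    refine (hνκ ?_).elim
    rintro ⟨i, j⟩ h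
    rw [← (Finset.mem_filter.1 hT).2]
    exact SkewTableau.mem_lowerPart.2 ⟨hνμ h, Or.inl h⟩

/-- Straight tableaux are skew tableaux with empty inner shape. -/
def semistandardEquivSkew (μ : YoungDiagram) : SemistandardYoungTableau μ ≃ SkewTableau μ ⊥ where
  toFun T := ⟨fun i j => T i j, fun h _ h' => T.row_weak h h', fun h _ h' => T.col_strict h h',
    fun h => T.zeros fun h' => h ⟨h', YoungDiagram.notMem_bot _⟩⟩
  invFun T := ⟨T.entry, fun h h' => T.row_weak h (YoungDiagram.notMem_bot _) h',
    fun h h' => T.col_strict h (YoungDiagram.notMem_bot _) h', fun h => T.zeros fun h' => h h'.1⟩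
  left_inv T := by ext; rfl
  right_inv T := by ext; rfl

theorem diagramSchur_eq_diagramSkewSchur (μ : YoungDiagram) :
    diagramSchur μ = diagramSkewSchur μ ⊥ := by
  ext d
  rw [coeff_diagramSkewSchur_of_le bot_le]
  change (Nat.card {T : SemistandardYoungTableau μ // tableauContent T = d} : ℤ) = _
  congr 1
  refine Nat.card_congr ((semistandardEquivSkew μ).subtypeEquiv fun T => ?_)
  have : skewContent (semistandardEquivSkew μ T) = tableauContent T := by
    unfold skewContent tableauContent
    simp [semistandardEquivSkew]
  rw [this]

/-! ### Complete homogeneous polynomials and a recursion for their determinants -/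

/-- The complete homogeneous symmetric polynomial of degree `m` in the variables
`x_0, …, x_{n-1}`, which is `0` for negative `m`. -/
noncomputable def completeHom : ℕ → ℤ → MvPolynomial ℕ ℤ
  | 0, m => if m = 0 then 1 else 0
  | n + 1, m => ∑ c ∈ Finset.range (m.toNat + 1), MvPolynomial.X n ^ c * completeHom n (m - c)

theorem completeHom_of_neg (n : ℕ) {m : ℤ} (hm : m < 0) : completeHom n m = 0 := by
  induction n generalizing m with
  | zero => rw [completeHom, if_neg hm.ne]
  | succ n ih =>
    rw [completeHom]
    exact Finset.sum_eq_zero fun c _ => by rw [ih (by omega), mul_zero]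

theorem completeHom_succ (n : ℕ) (m : ℤ) :
    completeHom (n + 1) m =
      completeHom n m + MvPolynomial.X n * completeHom (n + 1) (m - 1) := by
  rcases lt_trichotomy m 0 with hm | rfl | hm
  · rw [completeHom_of_neg _ hm, completeHom_of_neg _ hm, completeHom_of_neg _ (by omega)]
    simp
  · rw [completeHom_of_neg (n + 1) (by omega : (0 : ℤ) - 1 < 0), completeHom]
    simp
  · rw [completeHom, completeHom, Finset.sum_range_succ', add_comm, Finset.mul_sum,
      show (m - 1).toNat + 1 = m.toNat by omega]
    congr 1
    · simp
    · refine Finset.sum_congr rfl fun c _ => ?_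
      rw [pow_succ', mul_assoc]
      congr 3
      push_cast
      ring

/-- This iterates `completeHom_succ` from `y` down to `x`. With `y` and `x` the indices of
consecutive rows, the remainder is a multiple of the next row, with a factor that does not depend on
the column parameter `b`. -/
theorem completeHom_succ_eq_sum_Ioc (n : ℕ) (b : ℤ) {x y : ℤ} (h : x ≤ y) :
    completeHom (n + 1) (y - b) =
      ∑ z ∈ Finset.Ioc x y, MvPolynomial.X n ^ (y - z).toNat * completeHom n (z - b) +
        MvPolynomial.X n ^ (y - x).toNat * completeHom (n + 1) (x - b) := by
  induction y, h using Int.leInduction with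
  | base => simp
  | succ y hy ih =>
    have hI : Finset.Ioc x (y + 1) = insert (y + 1) (Finset.Ioc x y) := by
      ext z
      simp only [Finset.mem_Ioc, Finset.mem_insert]
      omega
    rw [completeHom_succ, show y + 1 - b - 1 = y - b by ring, ih, hI,
      Finset.sum_insert (by simp), mul_add, Finset.mul_sum, add_assoc]
    congr 1
    · simp
    congr 1
    · refine Finset.sum_congr rfl fun z hz => ?_
      rw [Finset.mem_Ioc] at hz
      rw [show (y + 1 - z).toNat = (y - z).toNat + 1 by omega, pow_succ', mul_assoc]
    · rw [show (y + 1 - x).toNat = (y - x).toNat + 1 by omega, pow_succ', mul_assoc]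

theorem Matrix.det_eq_of_forall_row_eq_smul_add_succ {R : Type*} [CommRing R] {n : ℕ}
    {A B : Matrix (Fin (n + 1)) (Fin (n + 1)) R} (c : Fin n → R)
    (h_last : ∀ j, A (Fin.last n) j = B (Fin.last n) j)
    (h : ∀ i j, A (Fin.castSucc i) j = B (Fin.castSucc i) j + c i * A i.succ j) :
    A.det = B.det := by
  rw [← Matrix.det_submatrix_equiv_self Fin.revPerm A,
    ← Matrix.det_submatrix_equiv_self Fin.revPerm B]
  refine Matrix.det_eq_of_forall_row_eq_smul_add_pred (fun i => c i.rev) ?_ ?_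
  · intro j
    simpa using h_last _
  · intro i j
    simpa [Fin.rev_succ, Fin.rev_castSucc] using h i.rev j.rev

/-- Subtracting from each row a multiple of the next one leaves in row `i` a sum over `z` in `(a (i
+ 1), a i]`; multilinearity in the rows then expands the determinant over all choices of one `z` per
row. -/
theorem det_completeHom_succ (n : ℕ) {l : ℕ} {a : ℕ → ℤ} (ha : ∀ i, a (i + 1) ≤ a i)
    {b : Fin l → ℤ} (hb : ∀ j, a l < b j) :
    (Matrix.of fun i j : Fin l => completeHom (n + 1) (a i - b j)).det =
      ∑ r ∈ Fintype.piFinset fun i : Fin l => Finset.Ioc (a (i + 1)) (a i),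
        MvPolynomial.X n ^ (∑ i : Fin l, (a i - r i).toNat) *
          (Matrix.of fun i j : Fin l => completeHom n (r i - b j)).det := by
  have key : (Matrix.of fun i j : Fin l => completeHom (n + 1) (a i - b j)).det =
      (Matrix.of fun i : Fin l => ∑ z ∈ Finset.Ioc (a (i + 1)) (a i), fun j : Fin l =>
        MvPolynomial.X n ^ (a i - z).toNat * completeHom n (z - b j)).det := by
    cases l with
    | zero => rw [Matrix.det_isEmpty, Matrix.det_isEmpty]
    | succ p =>
      refine Matrix.det_eq_of_forall_row_eq_smul_add_succ
        (fun i => MvPolynomial.X n ^ (a i - a (i + 1)).toNat) ?_ ?_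
      · intro j
        simp only [Matrix.of_apply, Finset.sum_apply, Fin.val_last]
        -- The last row has no successor, but its remainder has negative degree because `a l < b j`.
        rw [completeHom_succ_eq_sum_Ioc n (b j) (ha p),
          completeHom_of_neg (n + 1) (m := a (p + 1) - b j) (by linarith [hb j]), mul_zero,
          add_zero]
      · intro i j
        simp only [Matrix.of_apply, Finset.sum_apply, Fin.val_castSucc, Fin.val_succ]
        exact completeHom_succ_eq_sum_Ioc n (b j) (ha i)
  rw [key]
  have h₁ := (Matrix.detRowAlternating (n := Fin l)
    (R := MvPolynomial ℕ ℤ)).toMultilinearMap.map_sum_finset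
    (fun (i : Fin l) (z : ℤ) (j : Fin l) =>
      MvPolynomial.X n ^ (a i - z).toNat * completeHom n (z - b j))
    (fun i : Fin l => Finset.Ioc (a (i + 1)) (a i))
  refine h₁.trans (Finset.sum_congr rfl fun r _ => ?_)
  have h₂ := (Matrix.detRowAlternating (n := Fin l)
    (R := MvPolynomial ℕ ℤ)).toMultilinearMap.map_smul_univ
    (fun i : Fin l => MvPolynomial.X n ^ (a i - r i).toNat) (fun i j : Fin l => completeHom n (r i - b j))
  rw [← Finset.prod_pow_eq_pow_sum]
  exact h₂

/-! ### Row lengths and beta numbers -/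

theorem IsPartitionSeq.mem_diagram {k : ℕ} {α : Fin k → ℤ} (h : IsPartitionSeq α) {i j : ℕ} :
    (i, j) ∈ h.diagram ↔ ∃ hi : i < k, j < (α ⟨i, hi⟩).toNat := by
  unfold IsPartitionSeq.diagram
  rw [YoungDiagram.mem_ofRowLens]
  simp

theorem IsPartitionSeq.rowLen_diagram {k : ℕ} {α : Fin k → ℤ} (h : IsPartitionSeq α)
    (i : Fin k) : (h.diagram.rowLen i : ℤ) = α i := by
  rw [← Int.toNat_of_nonneg (h.2 i), Nat.cast_inj]
  refine eq_of_forall_lt_iff fun j => ?_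
  rw [← YoungDiagram.mem_iff_lt_rowLen, h.mem_diagram]
  simp

theorem IsPartitionSeq.rowLen_diagram_self {k : ℕ} {α : Fin k → ℤ} (h : IsPartitionSeq α) :
    h.diagram.rowLen k = 0 := by
  by_contra h₀
  have h₁ := YoungDiagram.mem_iff_lt_rowLen.2 (Nat.pos_of_ne_zero h₀)
  obtain ⟨hi, -⟩ := h.mem_diagram.1 h₁
  exact lt_irrefl _ hi

namespace YoungDiagram

theorem le_iff_rowLen_le {μ ν : YoungDiagram} : μ ≤ ν ↔ ∀ i, μ.rowLen i ≤ ν.rowLen i := by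
  constructor
  · intro h i
    by_contra! h₀
    have h₁ := h (mem_iff_lt_rowLen.2 h₀)
    exact lt_irrefl _ (mem_iff_lt_rowLen.1 h₁)
  · rintro h ⟨i, j⟩ hc
    exact mem_iff_lt_rowLen.2 ((mem_iff_lt_rowLen.1 hc).trans_le (h i))

theorem ext_rowLen {l : ℕ} {μ ν : YoungDiagram} (hμ : μ.rowLen l = 0) (hν : ν.rowLen l = 0)
    (h : ∀ i < l, μ.rowLen i = ν.rowLen i) : μ = ν := by
  have h' : ∀ i, μ.rowLen i = ν.rowLen i := by
    intro i
    rcases lt_or_ge i l with hi | hi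
    · exact h i hi
    · have := μ.rowLen_anti l i hi
      have := ν.rowLen_anti l i hi
      omega
  exact le_antisymm (le_iff_rowLen_le.2 fun i => (h' i).le)
    (le_iff_rowLen_le.2 fun i => (h' i).ge)

theorem card_eq_sum_rowLen {l : ℕ} {μ : YoungDiagram} (hμ : μ.rowLen l = 0) :
    μ.card = ∑ i : Fin l, μ.rowLen i := by
  rw [Fin.sum_univ_eq_sum_range (fun i => μ.rowLen i), YoungDiagram.card,
    Finset.card_eq_sum_card_fiberwise (f := Prod.fst) (t := Finset.range l)]
  · exact Finset.sum_congr rfl fun i _ => (μ.rowLen_eq_card).symm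
  · rintro ⟨i, j⟩ hc
    have h₁ := mem_iff_lt_rowLen.1 ((mem_cells _).1 hc)
    by_contra h₂
    have := μ.rowLen_anti l i (by simpa using h₂)
    omega

/-- The beta number `μ_i - i` of the `i`-th row. -/
def beta (μ : YoungDiagram) (i : ℕ) : ℤ :=
  μ.rowLen i - i

theorem beta_strictAnti (μ : YoungDiagram) : StrictAnti μ.beta := by
  refine strictAnti_nat_of_succ_lt fun i => ?_
  have := μ.rowLen_anti i (i + 1) (Nat.le_add_right _ _)
  unfold beta
  push_cast
  omega

end YoungDiagram

/-- The condition is that the row lengths interlace. The shift by the row index turns the weak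
inequality with the next row of `μ` into a strict one, whence the half-open intervals of
`det_completeHom_succ`. -/
theorem mem_horizontalStrips_iff {κ μ : YoungDiagram} :
    κ ∈ horizontalStrips μ ↔ ∀ i, κ.beta i ∈ Finset.Ioc (μ.beta (i + 1)) (μ.beta i) := by
  have h₁ : (∀ i j, (i + 1, j) ∈ μ → (i, j) ∈ κ) ↔ ∀ i, μ.rowLen (i + 1) ≤ κ.rowLen i := by
    simp only [YoungDiagram.mem_iff_lt_rowLen]
    exact forall_congr' fun i => ⟨fun h => by by_contra! h'; exact lt_irrefl _ (h _ h'),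
      fun h j hj => hj.trans_le h⟩
  rw [horizontalStrips, Set.mem_ofPred_eq, h₁, YoungDiagram.le_iff_rowLen_le, ← forall_and]
  refine forall_congr' fun i => ?_
  rw [Finset.mem_Ioc, YoungDiagram.beta, YoungDiagram.beta, YoungDiagram.beta]
  push_cast
  omega

/-! ### The Jacobi–Trudi formula -/

theorem det_completeHom_zero {l : ℕ} {μ ν : YoungDiagram} (hμ : μ.rowLen l = 0)
    (hν : ν.rowLen l = 0) [Decidable (μ = ν)] :
    (Matrix.of fun i j : Fin l => completeHom 0 (μ.beta i - ν.beta j)).det =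
      if μ = ν then 1 else 0 := by
  split_ifs with h
  · subst h
    convert Matrix.det_one (n := Fin l) (R := MvPolynomial ℕ ℤ) using 2
    ext1 i j
    simp only [Matrix.of_apply, completeHom, Matrix.one_apply, sub_eq_zero,
      μ.beta_strictAnti.injective.eq_iff, Fin.val_inj]
  · have : ∃ i : Fin l, ∀ j : Fin l, μ.beta i ≠ ν.beta j := by
      -- If no row vanished, every beta number of `μ` would be one of `ν`. The resulting strictly
      -- increasing self-map of `Fin l` is the identity, which forces `μ = ν`.
      by_contra! hf
      choose f hf using hf
      have hf_mono : StrictMono f := fun i j hij => by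
        have := μ.beta_strictAnti (Fin.lt_def.1 hij)
        rw [hf, hf, ν.beta_strictAnti.lt_iff_gt] at this
        exact this
      have hf_id : f = id := hf_mono.eq_id
      refine h (YoungDiagram.ext_rowLen hμ hν fun i hi => ?_)
      have := hf ⟨i, hi⟩
      simpa [hf_id, YoungDiagram.beta] using this
    obtain ⟨i, hi⟩ := this
    refine Matrix.det_eq_zero_of_row_eq_zero i fun j => ?_
    simp [completeHom, sub_eq_zero, hi j]

/-- The Jacobi–Trudi formula for skew Schur polynomials. -/
theorem boundedSkewSchur_eq_det (n : ℕ) {l : ℕ} {μ ν : YoungDiagram} (hμ : μ.rowLen l = 0)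
    (hν : ν.rowLen l = 0) :
    boundedSkewSchur n μ ν =
      (Matrix.of fun i j : Fin l => completeHom n (μ.beta i - ν.beta j)).det := by
  classical
  induction n generalizing μ with
  | zero => rw [boundedSkewSchur_zero, det_completeHom_zero hμ hν]
  | succ n ih =>
    have hbeta : ∀ j : Fin l, μ.beta l < ν.beta j := by
      intro j
      have := j.2
      unfold YoungDiagram.beta
      omega
    have hrow : ∀ κ ∈ (finite_horizontalStrips μ).toFinset, κ.rowLen l = 0 := by
      intro κ hκ
      rw [Set.Finite.mem_toFinset] at hκ
      have := YoungDiagram.le_iff_rowLen_le.1 hκ.1 l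
      omega
    rw [boundedSkewSchur_succ, det_completeHom_succ n
      (fun i => (μ.beta_strictAnti (Nat.lt_add_one i)).le) hbeta]
    refine Finset.sum_bij (fun κ _ i => κ.beta i) ?_ ?_ ?_ ?_
    · intro κ hκ
      rw [Set.Finite.mem_toFinset, mem_horizontalStrips_iff] at hκ
      exact Fintype.mem_piFinset.2 fun i => hκ i
    · intro κ hκ κ' hκ' h
      refine YoungDiagram.ext_rowLen (hrow κ hκ) (hrow κ' hκ') fun i hi => ?_
      have := congrFun h ⟨i, hi⟩
      simpa [YoungDiagram.beta] using this
    · intro r hr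
      rw [Fintype.mem_piFinset] at hr
      simp only [Finset.mem_Ioc, YoungDiagram.beta] at hr
      -- Adding the row index recovers row lengths. They decrease because the intervals of distinct
      -- rows are disjoint and ordered; they are nonnegative because the lower endpoint in row `i`
      -- is at least `-(i + 1)` and is excluded.
      have hr' : IsPartitionSeq fun i => r i + (i : ℕ) := by
        constructor
        · intro i j hij
          rcases hij.eq_or_lt with rfl | hij
          · exact le_rfl
          · have h₁ := hr i
            have h₂ := hr j
            have h₃ := μ.rowLen_anti (i + 1) j hij
            push_cast at h₁ h₂
            dsimp only
            omega
        · intro i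
          have h₁ := hr i
          push_cast at h₁
          dsimp only
          omega
      refine ⟨hr'.diagram, ?_, ?_⟩
      · rw [Set.Finite.mem_toFinset, mem_horizontalStrips_iff]
        intro i
        rw [Finset.mem_Ioc]
        unfold YoungDiagram.beta
        rcases lt_or_ge i l with hi | hi
        · have := hr'.rowLen_diagram ⟨i, hi⟩
          have := hr ⟨i, hi⟩
          dsimp only at *
          push_cast at *
          omega
        · have := hr'.diagram.rowLen_anti l i hi
          have := hr'.rowLen_diagram_self
          have := μ.rowLen_anti l i hi
          have := μ.rowLen_anti l (i + 1) (by omega)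
          push_cast
          omega
      · funext i
        have := hr'.rowLen_diagram i
        unfold YoungDiagram.beta
        omega
    · intro κ hκ
      have hκl := hrow κ hκ
      rw [ih hκl, YoungDiagram.card_eq_sum_rowLen hμ, YoungDiagram.card_eq_sum_rowLen hκl]
      rw [Set.Finite.mem_toFinset] at hκ
      have hsub : ∑ i : Fin l, (μ.rowLen i - κ.rowLen i) =
          ∑ i : Fin l, μ.rowLen i - ∑ i : Fin l, κ.rowLen i :=
        Finset.sum_tsub_distrib _ fun i _ => YoungDiagram.le_iff_rowLen_le.1 hκ.1 i
      rw [← hsub]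
      congr 2
      refine Finset.sum_congr rfl fun i _ => ?_
      dsimp only [YoungDiagram.beta]
      omega

/-! ### The three-term Plücker relation -/

section Pluecker

variable {R : Type*} [CommRing R]

theorem Matrix.det_snoc {n : ℕ} (v : Fin n → Fin (n + 1) → R) (a : Fin (n + 1) → R) :
    (Matrix.of (Fin.snoc v a : Fin (n + 1) → Fin (n + 1) → R)).det =
      (-1) ^ n * (Matrix.of (Fin.cons a v : Fin (n + 1) → Fin (n + 1) → R)).det := by
  rw [Fin.snoc_eq_cons_rotate]
  have := Matrix.det_permute (finRotate (n + 1))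
    (Matrix.of (Fin.cons a v : Fin (n + 1) → Fin (n + 1) → R))
  rw [sign_finRotate] at this
  push_cast at this
  exact this

theorem Matrix.det_cons_cons_swap {n : ℕ} (v : Fin n → Fin (n + 2) → R)
    (a b : Fin (n + 2) → R) :
    (Matrix.of (Fin.cons a (Fin.cons b v : Fin (n + 1) → Fin (n + 2) → R) :
      Fin (n + 2) → Fin (n + 2) → R)).det =
    -(Matrix.of (Fin.cons b (Fin.cons a v : Fin (n + 1) → Fin (n + 2) → R) :
      Fin (n + 2) → Fin (n + 2) → R)).det := by
  have h := Matrix.det_permute (Equiv.swap (0 : Fin (n + 2)) 1)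
    (Matrix.of (Fin.cons b (Fin.cons a v : Fin (n + 1) → Fin (n + 2) → R) :
      Fin (n + 2) → Fin (n + 2) → R))
  rw [Equiv.Perm.sign_swap (by simp)] at h
  simp only [Units.val_neg, Units.val_one, Int.cast_neg, Int.cast_one, neg_one_mul] at h
  rw [← h]
  congr 1
  ext i j
  refine Fin.cases ?_ (fun i => Fin.cases ?_ (fun i => ?_) i) i
  · simp
  · simp
  · rw [Matrix.submatrix_apply, Equiv.swap_apply_of_ne_of_ne (by simp)
      (by rw [← Fin.succ_zero_eq_one, Ne, Fin.succ_inj]; simp)]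
    simp

/-- The determinant with rows `u, c_0, …, c_{m-1}, v`. -/
def borderedDet {m : ℕ} (c : Fin m → Fin (m + 2) → R) (u v : Fin (m + 2) → R) : R :=
  (Matrix.of (Fin.cons u (Fin.snoc c v : Fin (m + 1) → Fin (m + 2) → R) :
    Fin (m + 2) → Fin (m + 2) → R)).det

/-- The three-term Plücker relation. -/
theorem borderedDet_mul_borderedDet {m : ℕ} (c : Fin m → Fin (m + 2) → R)
    (a b x e : Fin (m + 2) → R) :
    borderedDet c a b * borderedDet c x e =
      borderedDet c x b * borderedDet c a e + borderedDet c a x * borderedDet c b e := by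
  let B : Fin (m + 2) → Fin (m + 2) → R :=
    Fin.cons a (Fin.snoc c b : Fin (m + 1) → Fin (m + 2) → R)
  have hB : B = Fin.cons a (Fin.snoc c b : Fin (m + 1) → Fin (m + 2) → R) := rfl
  let f : (Fin (m + 2) → R) →ₗ[R] R :=
    (Matrix.detRowAlternating (n := Fin (m + 2)) (R := R)).toMultilinearMap.toLinearMap
      (Fin.cons a (Fin.snoc c e : Fin (m + 1) → Fin (m + 2) → R)) 0
  have hf : ∀ w, f w = borderedDet c w e := by
    intro w
    change Matrix.det (Function.update _ _ _) = _
    rw [Fin.update_cons_zero]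
    rfl
  -- Cramer's rule expands `x` in the rows of `B`. Applying the functional `f` to this expansion
  -- gives the relation.
  have hA : (Matrix.of B).det • x = ∑ i, (Matrix.of (Function.update B i x)).det • B i := by
    have h := Matrix.mulVec_cramer (Matrix.of B).transpose x
    rw [Matrix.det_transpose] at h
    rw [← h]
    ext j
    rw [Finset.sum_apply, Matrix.mulVec, dotProduct]
    refine Finset.sum_congr rfl fun i _ => ?_
    rw [Matrix.cramer_transpose_apply, mul_comm]
    rfl
  have h := congrArg f hA
  rw [map_smul, map_sum, Fin.sum_univ_succ, Fin.sum_univ_castSucc] at h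
  simp only [map_smul, smul_eq_mul] at h
  simp only [hf] at h
  -- The rows of `B` coming from `c` contribute nothing, since `f` puts them next to a second copy
  -- of themselves.
  have h_zero : ∀ i : Fin m, borderedDet c (B i.castSucc.succ) e = 0 := by
    intro i
    refine Matrix.det_zero_of_row_eq (i := 0) (j := i.castSucc.succ) (Fin.succ_ne_zero _).symm ?_
    ext j
    rw [Matrix.of_apply, Matrix.of_apply, Fin.cons_zero, Fin.cons_succ, Fin.snoc_castSucc, hB,
      Fin.cons_succ, Fin.snoc_castSucc]
  have h_first : (Matrix.of (Function.update B 0 x)).det = borderedDet c x b := by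
    rw [hB, Fin.update_cons_zero]
    rfl
  have h_last : (Matrix.of (Function.update B (Fin.last m).succ x)).det = borderedDet c a x := by
    rw [hB, ← Fin.cons_update, Fin.update_snoc_last]
    rfl
  have h₀ : B 0 = a := rfl
  have h₁ : B (Fin.last m).succ = b := by rw [hB, Fin.cons_succ, Fin.snoc_last]
  simp only [h_zero, mul_zero, Finset.sum_const_zero, zero_add, h_first, h_last, h₀, h₁] at h
  exact h

/-- Laplace expansion along the unit vector: bordering by it deletes a coordinate, up to sign. -/
theorem borderedDet_single {m : ℕ} (c : Fin m → Fin (m + 2) → R) (u : Fin (m + 2) → R)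
    (r : Fin (m + 2)) :
    borderedDet c u (Pi.single r 1) =
      (-1) ^ (m + 1 + r : ℕ) * (Matrix.of fun j i : Fin (m + 1) =>
        (Fin.cons u c : Fin (m + 1) → Fin (m + 2) → R) j (r.succAbove i)).det := by
  rw [borderedDet, Fin.cons_snoc_eq_snoc_cons, Matrix.det_succ_row _ (Fin.last (m + 1)),
    Finset.sum_eq_single r]
  · simp only [Matrix.of_apply, Fin.snoc_last, Pi.single_eq_same, mul_one, Fin.val_last]
    congr 2
    ext j i
    simp
  · intro i _ hi
    simp [Pi.single_eq_of_ne hi]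
  · simp

/-- The Plücker relation between the maximal minors of `m + 3` vectors and of the same vectors
with the `r`-th coordinate removed. -/
theorem det_mul_det_succAbove {m : ℕ} (w : ℕ → Fin (m + 2) → R) (r : Fin (m + 2)) :
    (Matrix.of fun j : Fin (m + 2) => if j = 0 then w 0 else w (j + 1)).det *
        (Matrix.of fun j i : Fin (m + 1) => w (j + 1) (r.succAbove i)).det =
      (Matrix.of fun j i : Fin (m + 1) =>
          (if j = 0 then w 0 else w (j + 1)) (r.succAbove i)).det *
        (Matrix.of fun j : Fin (m + 2) => w (j + 1)).det +
      (Matrix.of fun j : Fin (m + 2) => w j).det *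
        (Matrix.of fun j i : Fin (m + 1) => w (j + 2) (r.succAbove i)).det := by
  let c : Fin m → Fin (m + 2) → R := fun j => w (j + 2)
  have h_snoc : (Fin.snoc c (w (m + 2)) : Fin (m + 1) → Fin (m + 2) → R) =
      fun j : Fin (m + 1) => w (j + 2) := by
    funext j
    refine Fin.lastCases ?_ (fun j => ?_) j <;> simp [c]
  have h_cons₁ : (Fin.cons (w 1) c : Fin (m + 1) → Fin (m + 2) → R) =
      fun j : Fin (m + 1) => w (j + 1) := by
    funext j
    refine Fin.cases ?_ (fun j => ?_) j <;> simp [c]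
  have h_cons₀ : (Fin.cons (w 0) c : Fin (m + 1) → Fin (m + 2) → R) =
      fun j : Fin (m + 1) => if j = 0 then w 0 else w (j + 1) := by
    funext j
    refine Fin.cases ?_ (fun j => ?_) j <;> simp [c]
  have h₁ : borderedDet c (w 0) (w (m + 2)) =
      (Matrix.of fun j : Fin (m + 2) => if j = 0 then w 0 else w (j + 1)).det := by
    rw [borderedDet, h_snoc]
    congr 2
    funext j
    refine Fin.cases ?_ (fun j => ?_) j <;> simp
  have h₂ : borderedDet c (w 1) (w (m + 2)) =
      (Matrix.of fun j : Fin (m + 2) => w (j + 1)).det := by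
    rw [borderedDet, h_snoc]
    congr 2
    funext j
    refine Fin.cases ?_ (fun j => ?_) j <;> simp
  have h₃ : borderedDet c (w 0) (w 1) =
      (-1) ^ m * (Matrix.of fun j : Fin (m + 2) => w j).det := by
    rw [borderedDet, Fin.cons_snoc_eq_snoc_cons, Matrix.det_snoc, Matrix.det_cons_cons_swap,
      h_cons₁, pow_succ, mul_neg, mul_neg_one, neg_mul, neg_neg]
    congr 3
    funext j
    refine Fin.cases ?_ (fun j => ?_) j <;> simp
  have h₄ : (Matrix.of fun j i : Fin (m + 1) => w (j + 2) (r.succAbove i)).det =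
      (-1) ^ m * (Matrix.of fun j i : Fin (m + 1) =>
        (Fin.cons (w (m + 2)) c : Fin (m + 1) → Fin (m + 2) → R) j (r.succAbove i)).det := by
    have h := Matrix.det_snoc (fun j i => c j (r.succAbove i))
      (fun i => w (m + 2) (r.succAbove i))
    convert h using 3
    · ext j i
      refine Fin.lastCases ?_ (fun j => ?_) j <;> simp [c]
    · congr 1
      ext j i
      refine Fin.cases ?_ (fun j => ?_) j <;> simp
  -- The vectors `w 2, …, w (m + 1)` are common to all six determinants. The sign of the unit vector
  -- occurs once in each term and cancels; the signs $(-1)^m$ from `h₃` and `h₄` balance each other.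
  have h := borderedDet_mul_borderedDet c (w 0) (w (m + 2)) (w 1) (Pi.single r 1)
  rw [borderedDet_single, borderedDet_single, borderedDet_single, h₁, h₂, h₃, h_cons₁,
    h_cons₀] at h
  have hs : ((-1 : R) ^ (m + 1 + r : ℕ)) * (-1) ^ (m + 1 + r : ℕ) = 1 := by
    rw [← mul_pow]; simp
  rw [h₄]
  linear_combination ((-1 : R) ^ (m + 1 + r : ℕ)) * h +
    (-((Matrix.of fun j : Fin (m + 2) => if j = 0 then w 0 else w (j + 1)).det *
        (Matrix.of fun j i : Fin (m + 1) => w (j + 1) (r.succAbove i)).det) +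
      (Matrix.of fun j i : Fin (m + 1) =>
          (if j = 0 then w 0 else w (j + 1)) (r.succAbove i)).det *
        (Matrix.of fun j : Fin (m + 2) => w (j + 1)).det +
      (-1) ^ m * (Matrix.of fun j : Fin (m + 2) => w j).det *
        (Matrix.of fun j i : Fin (m + 1) =>
        (Fin.cons (w (m + 2)) c : Fin (m + 1) → Fin (m + 2) → R) j (r.succAbove i)).det) * hs

end Pluecker

/-! ### From power series to polynomials -/

/-- The polynomial `p` and the power series `f` have the same coefficients at all monomials in
the variables `x_0, …, x_{n-1}`. -/
def AgreeBelow (n : ℕ) (f : MvPowerSeries ℕ ℤ) (p : MvPolynomial ℕ ℤ) : Prop :=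
  ∀ d : ℕ →₀ ℕ, d.support ⊆ Finset.range n → MvPowerSeries.coeff d f = p.coeff d

namespace AgreeBelow

variable {n : ℕ} {f g : MvPowerSeries ℕ ℤ} {p q : MvPolynomial ℕ ℤ}

theorem add (hf : AgreeBelow n f p) (hg : AgreeBelow n g q) : AgreeBelow n (f + g) (p + q) := by
  intro d hd
  rw [map_add, MvPolynomial.coeff_add, hf d hd, hg d hd]

theorem mul (hf : AgreeBelow n f p) (hg : AgreeBelow n g q) : AgreeBelow n (f * g) (p * q) := by
  classical
  intro d hd
  rw [MvPowerSeries.coeff_mul, MvPolynomial.coeff_mul]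
  refine Finset.sum_congr rfl fun x hx => ?_
  rw [Finset.HasAntidiagonal.mem_antidiagonal] at hx
  rw [hf _ ((Finsupp.support_mono (hx ▸ le_self_add)).trans hd),
    hg _ ((Finsupp.support_mono (hx ▸ le_add_self)).trans hd)]

theorem eq_of_forall (h : ∀ n, ∃ p, AgreeBelow n f p ∧ AgreeBelow n g p) : f = g := by
  ext d
  obtain ⟨n, hn⟩ := Finset.exists_nat_subset_range d.support
  obtain ⟨p, hf, hg⟩ := h n
  rw [hf d hn, hg d hn]

end AgreeBelow

/-! ### Determinants for decreasing integer sequences -/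

theorem YoungDiagram.rowLen_bot (i : ℕ) : (⊥ : YoungDiagram).rowLen i = 0 := by
  by_contra h
  exact notMem_bot _ (mem_iff_lt_rowLen.2 (Nat.pos_of_ne_zero h))

theorem rowLen_oneCell (i : ℕ) : oneCell.rowLen i = if i = 0 then 1 else 0 := by
  refine eq_of_forall_lt_iff fun j => ?_
  rw [← YoungDiagram.mem_iff_lt_rowLen, oneCell, YoungDiagram.mem_ofRowLens]
  split_ifs with h <;> simp [h]

theorem Antitone.last_neg_of_not_isPartitionSeq {k : ℕ} {α : Fin (k + 1) → ℤ} (hα : Antitone α)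
    (h : ¬ IsPartitionSeq α) : α (Fin.last k) < 0 := by
  by_contra! h₀
  exact h ⟨hα, fun i => h₀.trans (hα (Fin.le_last i))⟩

/-- A decreasing sequence that is not a partition ends in a negative number. All degrees belonging
to that part are then negative, so the determinant vanishes, in agreement with the convention
$s_\alpha=0$. -/
theorem agreeBelow_schurS (n : ℕ) {k : ℕ} {α : Fin k → ℤ} (hα : Antitone α) :
    AgreeBelow n (schurS α)
      (Matrix.of fun j i : Fin k => completeHom n (α i - (i : ℕ) + (j : ℕ))).det := by
  classical
  intro d hd
  rw [← Matrix.det_transpose]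
  by_cases h : IsPartitionSeq α
  · rw [schurS, dif_pos h, diagramSchur_eq_diagramSkewSchur, coeff_diagramSkewSchur hd,
      boundedSkewSchur_eq_det n h.rowLen_diagram_self (YoungDiagram.rowLen_bot k)]
    congr 2
    ext1 i j
    simp [YoungDiagram.beta, h.rowLen_diagram, YoungDiagram.rowLen_bot]
  · rw [schurS, dif_neg h]
    cases k with
    | zero => exact (h ⟨hα, fun i => i.elim0⟩).elim
    | succ k =>
      have := hα.last_neg_of_not_isPartitionSeq h
      rw [Matrix.det_eq_zero_of_row_eq_zero (Fin.last k)]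
      · simp
      · intro j
        have := j.2
        exact completeHom_of_neg n (by rw [Fin.val_last]; omega)

theorem agreeBelow_schurSkewOne (n : ℕ) {k : ℕ} {α : Fin (k + 1) → ℤ} (hα : Antitone α) :
    AgreeBelow n (schurSkewOne α)
      (Matrix.of fun j i : Fin (k + 1) =>
        completeHom n (α i - (i : ℕ) + if j = 0 then -1 else ((j : ℕ) : ℤ))).det := by
  classical
  intro d hd
  rw [← Matrix.det_transpose]
  by_cases h : IsPartitionSeq α
  · rw [schurSkewOne, dif_pos h, coeff_diagramSkewSchur hd,
      boundedSkewSchur_eq_det n h.rowLen_diagram_self (by simp [rowLen_oneCell])]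
    congr 2
    ext1 i j
    simp only [Matrix.of_apply, Matrix.transpose_apply, YoungDiagram.beta, h.rowLen_diagram,
      rowLen_oneCell, Fin.val_eq_zero_iff]
    congr 1
    split_ifs with hj
    · simp [hj, sub_eq_add_neg]
    · simp
  · rw [schurSkewOne, dif_neg h]
    have := hα.last_neg_of_not_isPartitionSeq h
    rw [Matrix.det_eq_zero_of_row_eq_zero (Fin.last k)]
    · simp
    · intro j
      have := j.2
      refine completeHom_of_neg n ?_
      rw [Fin.val_last]
      split_ifs <;> omega

theorem schurSkewOne_fin_zero (α : Fin 0 → ℤ) : schurSkewOne α = 0 := by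
  classical
  unfold schurSkewOne
  split_ifs with h
  · refine if_neg fun h₁ => ?_
    have h₂ := YoungDiagram.le_iff_rowLen_le.1 h₁ 0
    rw [h.rowLen_diagram_self, rowLen_oneCell] at h₂
    simp at h₂
  · rfl

theorem Antitone.omitLower {k : ℕ} {α : Fin (k + 1) → ℤ} (hα : Antitone α) (t : ℕ) :
    Antitone (omitLower α t) := by
  intro i j hij
  have h₁ := hα (Fin.castSucc_le_castSucc_iff.2 hij)
  have h₂ := hα (Fin.succ_le_succ_iff.2 hij)
  have h₃ := hα (Fin.castSucc_lt_succ (i := i)).le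
  have h₄ := Fin.le_def.1 hij
  unfold _root_.omitLower
  split_ifs <;> omega

theorem Antitone.omitRaise {k : ℕ} {α : Fin (k + 1) → ℤ} (hα : Antitone α) (t : ℕ) :
    Antitone (omitRaise α t) := by
  intro i j hij
  have h₁ := hα (Fin.castSucc_le_castSucc_iff.2 hij)
  have h₂ := hα (Fin.succ_le_succ_iff.2 hij)
  have h₃ := hα (Fin.castSucc_lt_succ (i := i)).le
  have h₄ := Fin.le_def.1 hij
  unfold _root_.omitRaise
  split_ifs <;> omega

/-- Parts after the deleted one move up by one place, and lowering them by 1 compensates for this.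
The shifted parts are thus those of `α` with one omitted. -/
theorem omitLower_sub {k : ℕ} (α : Fin (k + 1) → ℤ) (r : Fin (k + 1)) (i : Fin k) :
    omitLower α r i - (i : ℕ) = α (r.succAbove i) - (r.succAbove i : ℕ) := by
  unfold omitLower Fin.succAbove
  simp only [Fin.lt_def, Fin.val_castSucc]
  split_ifs
  · simp
  · push_cast [Fin.val_succ]
    ring

theorem omitRaise_eq_omitLower_add_one {k : ℕ} (α : Fin (k + 1) → ℤ) (t : ℕ) (i : Fin k) :
    omitRaise α t i = omitLower α t i + 1 := by
  unfold omitLower omitRaise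
  split_ifs <;> ring

theorem corollary6p5 (k : ℕ) (α : Fin (k + 1) → ℤ) (hα : IsPartitionSeq α)
    (t : ℕ) (ht : t ≤ k) :
    schurSkewOne α * schurS (omitLower α t) =
      schurSkewOne (omitLower α t) * schurS α +
        schurS (fun i => α i - 1) * schurS (omitRaise α t) := by
  have hα₁ : Antitone fun i => α i - 1 := fun i j hij => sub_le_sub_right (hα.1 hij) 1
  refine AgreeBelow.eq_of_forall fun n => ⟨_, (agreeBelow_schurSkewOne n hα.1).mul
    (agreeBelow_schurS n (hα.1.omitLower t)), ?_⟩
  have h_last := (agreeBelow_schurS n hα₁).mul (agreeBelow_schurS n (hα.1.omitRaise t))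
  cases k with
  | zero =>
    -- With a single part the Plücker relation is not available. Here $s_{\varnothing/1}=0$, and
    -- removing the first cell of a row leaves a row shorter by 1.
    rw [schurSkewOne_fin_zero, zero_mul, zero_add]
    convert h_last using 2
    · rw [Matrix.det_fin_one, Matrix.det_fin_one]
      simp [sub_eq_add_neg]
    · rw [Matrix.det_isEmpty, Matrix.det_isEmpty]
  | succ m =>
    have h_first := (agreeBelow_schurSkewOne n (hα.1.omitLower t)).mul
      (agreeBelow_schurS n hα.1)
    convert h_first.add h_last using 1
    obtain ⟨r, rfl⟩ : ∃ r : Fin (m + 2), (r : ℕ) = t := ⟨⟨t, by omega⟩, rfl⟩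
    -- The minors without coordinate `r` taken from `w 1, …, w (m + 1)`, from `w 0, w 2, …, w (m +
    -- 1)` and from `w 2, …, w (m + 2)` belong to `omitLower`, its skew version and `omitRaise`.
    convert det_mul_det_succAbove
      (fun b i => completeHom n (α i - (i : ℕ) - 1 + (b : ℕ))) r using 4 <;>
    · first | ext1 j i | (ext1 j; ext1 i)
      try simp only [Matrix.of_apply, ite_apply, omitRaise_eq_omitLower_add_one, add_sub_right_comm,
        omitLower_sub]
      try split_ifs
      all_goals congr 1; push_cast; ring
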